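/- Let $G=(V,E)$ be a finite directed graph with diffusion probabilities $p_{uv}\in(0,1]$ for $(u,v)\in E$ and seed activation probabilities $\beta_u\in(0,1]$ for $u\in V$. Let $\vec b\in\mathbb{Z}_{+}^V$, let $k\ge 0$ be a budget, and let $c(\langle u,i\rangle)>0$ be the cost of the $i$-th trial on $u$ ($1\le i\le \vec b(u)$), with $c(\langle u,i\rangle)\le c(\langle u,i+1\rangle)$ for $1\le i<\vec b(u)$. For $\vec x\in\mathbb{Z}_+^V$ put $c(\vec x)=\sum_{u}\sum_{i=1}^{\vec x(u)}c(\langle u,i\rangle)$. A realization $\phi$ assigns to every edge a state (live or blocked) and to every trial $\langle u,i\rangle$, $1\le i\le\vec b(u)$, a result (success or failure); all of these are independent, $(u,v)$ is live with probability $p_{uv}$, and $\langle u,i\rangle$ succeeds with probability $\beta_u$. Let $S(\vec x,\phi)$ be the set of nodes $u$ for which one of the trials $\langle u,1\rangle,\dots,\langle u,\vec x(u)\rangle$ succeeds under $\phi$, and let $f(\vec x,\phi)$ be the number of nodes reachable from $S(\vec x,\phi)$ through live edges. The partial realization $\psi$ generated by $\vec x$ under $\phi$ consists of the results of the trials $\langle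 u,i\rangle$, $i\le \vec x(u)$, and of the states of all edges leaving nodes reachable from $S(\vec x,\phi)$ through live edges; $\phi\sim\psi$ means that $\phi$ agrees with $\psi$. Put $\Delta(u|\vec x,\psi)=\mathbb{E}[f(\vec x+\vec e_u,\phi)-f(\vec x,\phi)\mid\phi\sim\psi]$. A randomized policy $\pi(\kappa)$, with a random source $\kappa$ independent of $\phi$, starts at $\vec x=\vec 0$ and repeatedly, depending on $\kappa$, $\vec x$ and the partial realization generated by $\vec x$ under $\phi$, either stops or selects a node $u$ and increases $\vec x(u)$ by $1$; $\eta(\pi(\kappa),\phi)$ is the vector at which it stops. It is feasible if, for every realization $\phi$, $\eta(\pi(\kappa),\phi)\le\vec b$ (almost surely in $\kappa$) and $\mathbb{E}_\kappa[c(\eta(\pi(\kappa),\phi))]\le k$. Let $f_{avg}(\pi(\kappa))=\mathbb{E}_{\phi}[f(\eta(\pi(\kappa),\phi),\phi)]$. The adaptive greedy policy $\pi^g(\kappa)$ does the following while $c(\vec x)<k$ and some node has $\vec x(u)<\vec b(u)$: it chooses $u^*$ maximizing $\Delta(u|\vec x,\psi)/c(\langle u,\vec x(u)+1\rangle)$ among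 the nodes with $\vec x(u)<\vec b(u)$ (ties are broken by an arbitrary rule depending on $\vec x$ and $\psi$); if $c(\vec x)+c(\langle u^*,\vec x(u^*)+1\rangle)>k$, it stops with probability $1-(k-c(\vec x))/c(\langle u^*,\vec x(u^*)+1\rangle)$; if it has not stopped, it increases $\vec x(u^*)$ by $1$. Then $\pi^g(\kappa)$ is feasible, and for every feasible randomized policy $\pi^*(\kappa)$, $$\mathbb{E}_\kappa[f_{avg}(\pi^g(\kappa))]\ge(1-e^{-1})\cdot\mathbb{E}_\kappa[f_{avg}(\pi^*(\kappa))].$$ -/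

import Mathlib

open MeasureTheory

noncomputable section

namespace IMMA

variable {V : Type*} [Fintype V] [DecidableEq V]

/-- Data of the problem on a directed graph `G`: diffusion probabilities `p u v ∈ (0,1]` on the
edges, seed activation probabilities `β u ∈ (0,1]`, the maximal number `b u` of trials on node `u`,
the cost `c u i > 0` of the `i`-th trial on `u` (`1 ≤ i ≤ b u`), and the budget `k ≥ 0`. -/
structure Data (G : Digraph V) where
  p : V → V → ℝ
  p_pos : ∀ u v, G.Adj u v → 0 < p u v
  p_le_one : ∀ u v, G.Adj u v → p u v ≤ 1
  β : V → ℝ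
  β_pos : ∀ u, 0 < β u
  β_le_one : ∀ u, β u ≤ 1
  b : V → ℕ
  c : V → ℕ → ℝ
  c_pos : ∀ u i, 1 ≤ i → i ≤ b u → 0 < c u i
  k : ℝ
  k_nonneg : 0 ≤ k

/-- The edges of `G`. -/
abbrev Edge (G : Digraph V) : Type _ := {e : V × V // G.Adj e.1 e.2}

/-- A graph realization: `true` for live edges, `false` for blocked ones. -/
abbrev GraphRealization (G : Digraph V) : Type _ := Edge G → Bool

variable {G : Digraph V} [DecidableRel G.Adj]

/-- The edge from `u` to `v` exists and is live in `g`. -/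
def Live (g : GraphRealization G) (u v : V) : Prop :=
  ∃ h : G.Adj u v, g ⟨(u, v), h⟩ = true

/-- The nodes reached from the seed set `S` through live edges. -/
def reach (g : GraphRealization G) (S : Set V) : Set V :=
  {v | ∃ u ∈ S, Relation.ReflTransGen (Live g) u v}

/-- `σ_g(S)`: the number of nodes reached from `S` in `g`. -/
def spread (g : GraphRealization G) (S : Set V) : ℕ := (reach g S).ncard

/-- A (full) realization: the state of every edge and the result of every trial.
The `(j+1)`-st trial on `u` has index `j : Fin (b u)`. -/
abbrev Realization (I : Data G) : Type _ :=
  GraphRealization G × ((u : V) → Fin (I.b u) → Bool)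

/-- The probability of a realization (all edges and trials are independent). -/
def Realization.prob (I : Data G) (φ : Realization I) : ℝ :=
  (∏ e : Edge G, if φ.1 e = true then I.p e.1.1 e.1.2 else 1 - I.p e.1.1 e.1.2) *
    ∏ u : V, ∏ j : Fin (I.b u), if φ.2 u j = true then I.β u else 1 - I.β u

/-- A partial realization: states of edges and trials, `none` being "unknown". -/
abbrev PartialRealization (I : Data G) : Type _ :=
  (Edge G → Option Bool) × ((u : V) → Fin (I.b u) → Option Bool)

/-- `φ ∼ ψ`: `φ` agrees with everything that is known in `ψ`. -/
def Consistent (I : Data G) (φ : Realization I) (ψ : PartialRealization I) : Prop :=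
  (∀ e s, ψ.1 e = some s → φ.1 e = s) ∧ ∀ u j s, ψ.2 u j = some s → φ.2 u j = s

/-- The nodes that become seeds under `φ` when the first `x u` trials on each `u` are made. -/
def seeds (I : Data G) (x : V → ℕ) (φ : Realization I) : Set V :=
  {u | ∃ j : Fin (I.b u), (j : ℕ) < x u ∧ φ.2 u j = true}

/-- `f(x, φ)`: the influence spread of the seeding vector `x` under `φ`. -/
def f (I : Data G) (x : V → ℕ) (φ : Realization I) : ℝ := spread φ.1 (seeds I x φ)

open Classical in
/-- The partial realization generated by `x` under `φ` (full-adoption feedback): the results of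
the trials made so far, and the states of all edges going out of nodes reached by the seeds. -/
def observe (I : Data G) (x : V → ℕ) (φ : Realization I) : PartialRealization I :=
  (fun e => if e.1.1 ∈ reach φ.1 (seeds I x φ) then some (φ.1 e) else none,
   fun u j => if (j : ℕ) < x u then some (φ.2 u j) else none)

/-- `c(x)`: the total cost of a seeding vector. -/
def cost (I : Data G) (x : V → ℕ) : ℝ := ∑ u, ∑ i ∈ Finset.Icc 1 (x u), I.c u i

open Classical in
/-- The conditional expectation of `h φ` given `φ ∼ ψ`. -/
def condExp (I : Data G) (ψ : PartialRealization I) (h : Realization I → ℝ) : ℝ :=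
  (∑ φ : Realization I with Consistent I φ ψ, Realization.prob I φ * h φ) /
    ∑ φ : Realization I with Consistent I φ ψ, Realization.prob I φ

/-- `Δ(u | x, ψ)`: the conditional expected marginal gain of increasing `x u` by `1`. -/
def gain (I : Data G) (u : V) (x : V → ℕ) (ψ : PartialRealization I) : ℝ :=
  condExp I ψ fun φ => f I (x + Pi.single u 1) φ - f I x φ

/-- A deterministic adaptive policy: from the current seeding vector and its partial realization it
selects the node of the next trial, or stops (`none`). A randomized policy with random source
`κ : K` is a function `K → Policy I`. -/
abbrev Policy (I : Data G) : Type _ := (V → ℕ) → PartialRealization I → Option V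

/-- One step of a policy under the realization `φ`. -/
def step (I : Data G) (π : Policy I) (φ : Realization I) (x : V → ℕ) : V → ℕ :=
  match π x (observe I x φ) with
  | none => x
  | some u => x + Pi.single u 1

/-- `η(π, φ)`: the seeding vector returned by the policy `π` under `φ`. The run is cut off
after `∑ b + 1` trials. This is harmless: a run that has not stopped by then has made more than
`∑ b` trials, so that its vector violates `η ≤ b`. -/
def eta (I : Data G) (π : Policy I) (φ : Realization I) : V → ℕ :=
  (step I π φ)^[∑ u, I.b u + 1] 0

/-- `f_avg(π)`: the expected influence spread of a deterministic policy. -/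
def favg (I : Data G) (π : Policy I) : ℝ :=
  ∑ φ : Realization I, Realization.prob I φ * f I (eta I π φ) φ

/-- `π` is a feasible randomized policy for the random source `κ` with law `μ`: it depends
measurably on `κ`, and under every realization it returns a vector at most `b` (almost surely)
whose expected cost is at most the budget `k`. -/
structure IsFeasible {K : Type*} [MeasurableSpace K] (I : Data G) (μ : Measure K)
    (π : K → Policy I) : Prop where
  measurable : ∀ x ψ o, MeasurableSet {κ | π κ x ψ = o}
  eta_le : ∀ φ : Realization I, ∀ᵐ κ ∂μ, eta I (π κ) φ ≤ I.b
  cost_le : ∀ φ : Realization I, ∫ κ, cost I (eta I (π κ) φ) ∂μ ≤ I.k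

/-- `sel` is a greedy selection rule: whenever some node has trials left, it selects a
node with trials left that maximizes `Δ(u | x, ψ) / c(⟨u, x u + 1⟩)` (ties are broken arbitrarily);
it returns `none` when no node has trials left. -/
def IsGreedySelection (I : Data G) (sel : Policy I) : Prop :=
  ∀ x ψ, (sel x ψ = none → ∀ u, I.b u ≤ x u) ∧
    ∀ u, sel x ψ = some u → x u < I.b u ∧
      ∀ v, x v < I.b v → gain I v x ψ / I.c v (x v + 1) ≤ gain I u x ψ / I.c u (x u + 1)

/-- The randomized adaptive greedy policy, with `κ` uniform on `[0,1]`. While `c(x) < k` it tries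
the selected node `u`; if this trial exceeds the budget, it stops before the trial with
probability `1 - (k - c(x)) / c(⟨u, x u + 1⟩)`. This random decision is taken at most
once in a run, since `c(x) > k` after such a trial. -/
def greedy (I : Data G) (sel : Policy I) (κ : unitInterval) : Policy I := fun x ψ =>
  open Classical in
  if cost I x < I.k then
    match sel x ψ with
    | none => none
    | some u =>
      if I.k < cost I x + I.c u (x u + 1) ∧ (I.k - cost I x) / I.c u (x u + 1) < (κ : ℝ)
      then none
      else some u
  else none

end IMMA

end

/-! Let `O φ` be the spread of a feasible policy under `φ`, averaged over its random source.
Condition on what `x` has revealed, and let `ρ` bound the gain per unit of cost of every trial still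
available. Adaptive submodularity (`sum_policy_gain_le`) says that any policy, run on top of `x`,
gains at most `ρ` per unit of its expected cost: a trial already contained in `x` adds nothing, and
a new one adds no more than it would right after `x` and costs at least as much as the next trial on
its node. Averaging over the random source turns the expected budget into the bound `ρ * k`; this is
`IsBenchmark`, the only property of the competitor that is used.

Now let `S` be the gap between `O` and `f(x)`, and `D` the gain of the greedy trial, of cost `c`,
both summed over one observation class. Taking the greedy ratio as `ρ` gives `S * c ≤ k * D`. With
remaining budget `B`, `IsBenchmark.le_greedyValue` shows by induction that greedy gains at least `(1
- exp (-B/k)) * S`. An affordable trial shrinks the gap to `S - D` and the budget to `B - c`; a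
trial over budget is made with probability `B/c` and gains `B/c * D ≥ B/k * S`, which suffices since
`1 - exp (-t) ≤ t`. At `x = 0` the factor is `1 - exp (-1)`.

The probabilistic tool is `sum_prob_eq_resample`: unobserved coordinates may be replaced by an
independent copy. -/

noncomputable section

namespace IMMA

/-! ### Reachability through live edges -/

section Reachability

variable {V : Type*} {G : Digraph V}

theorem subset_reach (g : GraphRealization G) (S : Set V) : S ⊆ reach g S :=
  fun u hu => ⟨u, hu, .refl⟩

theorem reach_mono (g : GraphRealization G) {S T : Set V} (h : S ⊆ T) : reach g S ⊆ reach g T :=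
  fun _ ⟨u, hu, hr⟩ => ⟨u, h hu, hr⟩

theorem reach_closed {g : GraphRealization G} {S : Set V} {u v : V} (hu : u ∈ reach g S)
    (h : Relation.ReflTransGen (Live g) u v) : v ∈ reach g S :=
  let ⟨s, hs, hr⟩ := hu; ⟨s, hs, hr.trans h⟩

/-- The reached set only depends on the edges leaving it. -/
theorem reach_congr {g g' : GraphRealization G} {S : Set V}
    (h : ∀ e : Edge G, e.1.1 ∈ reach g S → g' e = g e) : reach g' S = reach g S := by
  apply Set.Subset.antisymm
  · rintro v ⟨u, hu, hr⟩
    induction hr with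
    | refl => exact subset_reach _ _ hu
    | @tail a b _ hab ih =>
      obtain ⟨hadj, hl⟩ := hab
      exact reach_closed ih (.single ⟨hadj, by rw [← h ⟨(a, b), hadj⟩ ih]; exact hl⟩)
  · rintro v ⟨u, hu, hr⟩
    induction hr with
    | refl => exact subset_reach _ _ hu
    | @tail a b hua hab ih =>
      obtain ⟨hadj, hl⟩ := hab
      exact reach_closed ih
        (.single ⟨hadj, by rw [h ⟨(a, b), hadj⟩ ⟨u, hu, hua⟩]; exact hl⟩)

/-- The nodes outside `R` that are reached from `u` through live edges leaving nodes outside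
`R`. -/
def reachAvoiding (g : GraphRealization G) (R : Set V) (u : V) : Set V :=
  {v | v ∉ R ∧ Relation.ReflTransGen (fun a b => a ∉ R ∧ Live g a b) u v}

/-- This antitonicity is the combinatorial source of adaptive submodularity. -/
theorem reachAvoiding_anti (g : GraphRealization G) {R R' : Set V} (h : R' ⊆ R) (u : V) :
    reachAvoiding g R u ⊆ reachAvoiding g R' u :=
  fun _ ⟨hv, hr⟩ => ⟨fun h' => hv (h h'),
    Relation.ReflTransGen.mono (fun _ _ hab => ⟨fun h' => hab.1 (h h'), hab.2⟩) _ _ hr⟩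

theorem reachAvoiding_congr {g g' : GraphRealization G} {R : Set V} (u : V)
    (h : ∀ e : Edge G, e.1.1 ∉ R → g' e = g e) :
    reachAvoiding g' R u = reachAvoiding g R u := by
  have : (fun a b => a ∉ R ∧ Live g' a b) = fun a b => a ∉ R ∧ Live g a b := by
    funext a b
    refine propext (and_congr_right fun ha => exists_congr fun hab => ?_)
    rw [h ⟨(a, b), hab⟩ ha]
  simp only [reachAvoiding, this]

/-- `reach g S` is closed under live edges, so a live path ending outside it never meets it. Hence
the new nodes depend only on edges that have not been observed. -/
theorem reach_insert_diff (g : GraphRealization G) (S : Set V) (u : V) :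
    reach g (insert u S) \ reach g S = reachAvoiding g (reach g S) u := by
  ext v
  constructor
  · rintro ⟨⟨s, hs, hr⟩, hv⟩
    rcases hs with rfl | hs
    · refine ⟨hv, ?_⟩
      induction hr using Relation.ReflTransGen.head_induction_on with
      | refl => exact .refl
      | @head a b hab hbv ih =>
        exact .head ⟨fun ha => hv (reach_closed ha (.head hab hbv)), hab⟩ ih
    · exact absurd ⟨s, hs, hr⟩ hv
  · rintro ⟨hv, hr⟩
    exact ⟨⟨u, Set.mem_insert _ _, Relation.ReflTransGen.mono (fun _ _ h => h.2) _ _ hr⟩, hv⟩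

theorem spread_insert [Finite V] (g : GraphRealization G) (S : Set V) (u : V) :
    (spread g (insert u S) : ℝ) - spread g S = (reachAvoiding g (reach g S) u).ncard := by
  rw [← reach_insert_diff, sub_eq_iff_eq_add, spread, spread]
  exact_mod_cast (Set.ncard_sdiff_add_ncard_of_subset
    (reach_mono g (Set.subset_insert u S)) (Set.toFinite _)).symm

theorem spread_mono [Finite V] (g : GraphRealization G) {S T : Set V} (h : S ⊆ T) :
    spread g S ≤ spread g T :=
  Set.ncard_le_ncard (reach_mono g h) (Set.toFinite _)

end Reachability

/-! ### Observations and marginal spread -/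

section Observation

variable {V : Type*} {G : Digraph V}

theorem seeds_mono (I : Data G) {x y : V → ℕ} (h : x ≤ y) (φ : Realization I) :
    seeds I x φ ⊆ seeds I y φ :=
  fun u ⟨j, hj, hs⟩ => ⟨j, hj.trans_le (h u), hs⟩

theorem seeds_zero (I : Data G) (φ : Realization I) : seeds I 0 φ = ∅ := by
  ext u; simp [seeds]

theorem f_zero (I : Data G) (φ : Realization I) : f I 0 φ = 0 := by
  simp [f, spread, reach, seeds_zero]

theorem f_nonneg (I : Data G) (x : V → ℕ) (φ : Realization I) : 0 ≤ f I x φ := Nat.cast_nonneg _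

theorem f_mono [Finite V] (I : Data G) {x y : V → ℕ} (h : x ≤ y) (φ : Realization I) :
    f I x φ ≤ f I y φ :=
  Nat.cast_le.2 (spread_mono _ (seeds_mono I h φ))

theorem f_le [Finite V] (I : Data G) (x : V → ℕ) (φ : Realization I) : f I x φ ≤ Nat.card V :=
  Nat.cast_le.2 (Set.ncard_le_card _)

theorem consistent_observe_iff (I : Data G) (x : V → ℕ) (φ φ' : Realization I) :
    Consistent I φ' (observe I x φ) ↔
      (∀ e : Edge G, e.1.1 ∈ reach φ.1 (seeds I x φ) → φ'.1 e = φ.1 e) ∧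
        ∀ u (j : Fin (I.b u)), (j : ℕ) < x u → φ'.2 u j = φ.2 u j := by
  simp only [Consistent, observe]
  constructor
  · rintro ⟨h₁, h₂⟩
    exact ⟨fun e he => h₁ e _ (by simp [he]), fun u j hj => h₂ u j _ (by simp [hj])⟩
  · rintro ⟨h₁, h₂⟩
    constructor
    · intro e s hs
      split_ifs at hs with he
      rw [h₁ e he]; simpa using hs
    · intro u j s hs
      split_ifs at hs with hj
      rw [h₂ u j hj]; simpa using hs

theorem seeds_eq_of_consistent {I : Data G} {x : V → ℕ} {φ φ' : Realization I}
    (h : Consistent I φ' (observe I x φ)) : seeds I x φ' = seeds I x φ := by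
  rw [consistent_observe_iff] at h
  ext u
  refine exists_congr fun j => and_congr_right fun hj => ?_
  rw [h.2 u j hj]

theorem reach_eq_of_consistent {I : Data G} {x : V → ℕ} {φ φ' : Realization I}
    (h : Consistent I φ' (observe I x φ)) :
    reach φ'.1 (seeds I x φ') = reach φ.1 (seeds I x φ) := by
  rw [seeds_eq_of_consistent h]
  exact reach_congr ((consistent_observe_iff I x φ φ').1 h).1

/-- Conditioning on an observation thus means restricting to a fibre of `observe I x`; for fixed `x`
these fibres partition the realizations. -/
theorem consistent_iff_observe_eq (I : Data G) (x : V → ℕ) (φ φ' : Realization I) :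
    Consistent I φ' (observe I x φ) ↔ observe I x φ' = observe I x φ := by
  constructor
  · intro h
    have hr := reach_eq_of_consistent h
    rw [consistent_observe_iff] at h
    refine Prod.ext (funext fun e => ?_) (funext fun u => funext fun j => ?_)
    · simp only [observe]
      by_cases he : e.1.1 ∈ reach φ.1 (seeds I x φ)
      · rw [if_pos he, if_pos (hr ▸ he), h.1 e he]
      · rw [if_neg he, if_neg (hr ▸ he)]
    · simp only [observe]
      by_cases hj : (j : ℕ) < x u
      · rw [if_pos hj, if_pos hj, h.2 u j hj]
      · rw [if_neg hj, if_neg hj]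
  · intro h
    rw [← h, consistent_observe_iff]
    exact ⟨fun _ _ => rfl, fun _ _ _ => rfl⟩

theorem observe_eq_of_le {I : Data G} {x y : V → ℕ} (hxy : x ≤ y) {φ φ' : Realization I}
    (h : observe I y φ' = observe I y φ) : observe I x φ' = observe I x φ := by
  rw [← consistent_iff_observe_eq, consistent_observe_iff] at h ⊢
  exact ⟨fun e he => h.1 e (reach_mono _ (seeds_mono I hxy φ) he),
    fun u j hj => h.2 u j (hj.trans_le (hxy u))⟩

variable [DecidableEq V]

theorem seeds_add_single (I : Data G) (x : V → ℕ) (u : V) (hu : x u < I.b u) (φ : Realization I) :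
    seeds I (x + Pi.single u 1) φ =
      if φ.2 u ⟨x u, hu⟩ = true then insert u (seeds I x φ) else seeds I x φ := by
  ext v
  have key : v ∈ seeds I (x + Pi.single u 1) φ ↔
      (v = u ∧ φ.2 u ⟨x u, hu⟩ = true) ∨ v ∈ seeds I x φ := by
    constructor
    · rintro ⟨j, hj, hs⟩
      by_cases hjx : (j : ℕ) < x v
      · exact .inr ⟨j, hjx, hs⟩
      · by_cases hv : v = u
        · subst hv
          simp only [Pi.add_apply, Pi.single_eq_same] at hj
          have : j = ⟨x v, hu⟩ := Fin.ext (by simp; omega)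
          exact .inl ⟨rfl, this ▸ hs⟩
        · simp [hv] at hj
          exact absurd hj hjx
    · rintro (⟨rfl, hs⟩ | hv)
      · exact ⟨⟨x v, hu⟩, by simp, hs⟩
      · exact seeds_mono I (le_add_of_nonneg_right (fun _ => Nat.zero_le _)) φ hv
  rw [key]
  split_ifs with h <;> simp [h]

theorem f_add_single_sub [Finite V] (I : Data G) (x : V → ℕ) (u : V) (hu : x u < I.b u)
    (φ : Realization I) :
    f I (x + Pi.single u 1) φ - f I x φ =
      if φ.2 u ⟨x u, hu⟩ = true then
        ((reachAvoiding φ.1 (reach φ.1 (seeds I x φ)) u).ncard : ℝ) else 0 := by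
  simp only [f, seeds_add_single I x u hu φ]
  split_ifs with h
  · exact spread_insert _ _ _
  · simp

end Observation

/-! ### Resampling the unobserved coordinates -/

section Resampling

variable {V : Type*} {G : Digraph V} {I : Data G}

/-- The realization that follows `φ` where the partial realization `ω` is known and `φ'`
elsewhere. -/
def splice (ω : PartialRealization I) (φ φ' : Realization I) : Realization I :=
  (fun e => if (ω.1 e).isSome then φ.1 e else φ'.1 e,
   fun u j => if (ω.2 u j).isSome then φ.2 u j else φ'.2 u j)

theorem splice_splice (ω : PartialRealization I) (φ φ' : Realization I) :
    splice ω (splice ω φ φ') (splice ω φ' φ) = φ := by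
  refine Prod.ext (funext fun e => ?_) (funext fun u => funext fun j => ?_)
  · simp only [splice]; split_ifs <;> rfl
  · simp only [splice]; split_ifs <;> rfl

theorem consistent_splice_observe (x : V → ℕ) (φ φ' : Realization I) :
    Consistent I (splice (observe I x φ) φ φ') (observe I x φ) := by
  rw [consistent_observe_iff]
  refine ⟨fun e he => ?_, fun u j hj => ?_⟩ <;> simp [splice, observe, *]

theorem observe_splice (x : V → ℕ) (φ φ' : Realization I) :
    observe I x (splice (observe I x φ) φ φ') = observe I x φ :=
  (consistent_iff_observe_eq I x _ _).1 (consistent_splice_observe x φ φ')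

variable [Fintype V] [DecidableRel G.Adj]

theorem prob_nonneg (φ : Realization I) : 0 ≤ Realization.prob I φ := by
  refine mul_nonneg (Finset.prod_nonneg fun e _ => ?_)
    (Finset.prod_nonneg fun u _ => Finset.prod_nonneg fun j _ => ?_)
  · split_ifs
    · exact (I.p_pos _ _ e.2).le
    · exact sub_nonneg.2 (I.p_le_one _ _ e.2)
  · split_ifs
    · exact (I.β_pos u).le
    · exact sub_nonneg.2 (I.β_le_one u)

theorem prob_splice_mul (ω : PartialRealization I) (φ φ' : Realization I) :
    Realization.prob I (splice ω φ φ') * Realization.prob I (splice ω φ' φ) =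
      Realization.prob I φ * Realization.prob I φ' := by
  have hmul : ∀ {a b c d a' b' c' d' : ℝ}, a * c = a' * c' → b * d = b' * d' →
      a * b * (c * d) = a' * b' * (c' * d') := fun h h' => by
    rw [mul_mul_mul_comm, h, h', mul_mul_mul_comm]
  simp only [Realization.prob]
  refine hmul ?_ ?_ <;> simp only [← Finset.prod_mul_distrib]
  · refine Finset.prod_congr rfl fun e _ => ?_
    by_cases h : (ω.1 e).isSome <;> simp [splice, h, mul_comm]
  · refine Finset.prod_congr rfl fun u _ => Finset.prod_congr rfl fun j _ => ?_
    by_cases h : (ω.2 u j).isSome <;> simp [splice, h, mul_comm]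

variable [DecidableEq V]

theorem sum_prob (I : Data G) : ∑ φ : Realization I, Realization.prob I φ = 1 := by
  have hb : ∀ a : ℝ, ∑ s : Bool, (if s = true then a else 1 - a) = 1 := fun a => by simp
  have h₁ : ∑ g : Edge G → Bool,
      ∏ e : Edge G, (if g e = true then I.p e.1.1 e.1.2 else 1 - I.p e.1.1 e.1.2) = 1 := by
    have := Finset.prod_univ_sum (fun _ : Edge G => (Finset.univ : Finset Bool))
      fun e s => if s = true then I.p e.1.1 e.1.2 else 1 - I.p e.1.1 e.1.2
    rw [Fintype.piFinset_univ] at this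
    rw [← this]; simp only [hb, Finset.prod_const_one]
  have h₂ : ∑ t : (u : V) → Fin (I.b u) → Bool,
      ∏ u : V, ∏ j : Fin (I.b u), (if t u j = true then I.β u else 1 - I.β u) = 1 := by
    have := Finset.prod_univ_sum (fun u : V => (Finset.univ : Finset (Fin (I.b u) → Bool)))
      fun u t => ∏ j, if t j = true then I.β u else 1 - I.β u
    rw [Fintype.piFinset_univ] at this
    rw [← this]
    refine Finset.prod_eq_one fun u _ => ?_
    have := Finset.prod_univ_sum (fun _ : Fin (I.b u) => (Finset.univ : Finset Bool))
      fun _ s => if s = true then I.β u else 1 - I.β u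
    rw [Fintype.piFinset_univ] at this
    rw [← this]; simp only [hb, Finset.prod_const_one]
  rw [Fintype.sum_prod_type]
  calc _ = ∑ g : Edge G → Bool,
          (∏ e : Edge G, (if g e = true then I.p e.1.1 e.1.2 else 1 - I.p e.1.1 e.1.2)) *
            ∑ t : (u : V) → Fin (I.b u) → Bool,
              ∏ u : V, ∏ j : Fin (I.b u), (if t u j = true then I.β u else 1 - I.β u) :=
        Finset.sum_congr rfl fun g _ => (Finset.mul_sum _ _ _).symm
    _ = 1 := by simp only [h₂, mul_one, h₁]

/-- Resampling everything that a stopping rule has not observed does not change expectations. -/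
theorem sum_prob_eq_resample (Z : Realization I → V → ℕ)
    (hZ : ∀ φ φ', observe I (Z φ) φ' = observe I (Z φ) φ → Z φ' = Z φ) (F : Realization I → ℝ) :
    ∑ φ : Realization I, Realization.prob I φ * F φ = ∑ φ, Realization.prob I φ *
      ∑ φ', Realization.prob I φ' * F (splice (observe I (Z φ) φ) φ φ') := by
  -- `T` exchanges, between two independent copies, the coordinates that the first has not revealed.
  -- By `hZ` the revealed set is the same after the exchange, so `T` is an involution; it preserves
  -- the product weight.
  let T : Realization I × Realization I → Realization I × Realization I := fun q =>
    (splice (observe I (Z q.1) q.1) q.1 q.2, splice (observe I (Z q.1) q.1) q.2 q.1)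
  have hT : Function.Involutive T := by
    rintro ⟨φ, φ'⟩
    have h₁ := observe_splice (Z φ) φ φ'
    have h₂ := hZ _ _ h₁
    simp only [T, h₂, h₁, splice_splice]
  calc ∑ φ : Realization I, Realization.prob I φ * F φ
      = ∑ q : Realization I × Realization I,
          Realization.prob I q.1 * Realization.prob I q.2 * F q.1 := by
        refine Eq.trans (Finset.sum_congr rfl fun φ _ => ?_) (Fintype.sum_prod_type _).symm
        have h := Finset.mul_sum Finset.univ (fun φ' => Realization.prob I φ')
          (Realization.prob I φ * F φ)
        rw [sum_prob, mul_one] at h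
        rw [h]
        exact Finset.sum_congr rfl fun φ' _ => mul_right_comm _ _ _
    _ = ∑ q : Realization I × Realization I,
          Realization.prob I (T q).1 * Realization.prob I (T q).2 * F (T q).1 :=
        (Equiv.sum_comp hT.toPerm (fun q : Realization I × Realization I =>
          Realization.prob I q.1 * Realization.prob I q.2 * F q.1)).symm
    _ = _ := by
        refine (Fintype.sum_prod_type _).trans (Finset.sum_congr rfl fun φ _ => ?_)
        rw [Finset.mul_sum]
        refine Finset.sum_congr rfl fun φ' _ => ?_
        simp only [T, prob_splice_mul, mul_assoc]

/-- The expected number of additional nodes reached by the trial `j` on `u` when the nodes in `R`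
are already reached and nothing else is known. -/
def marginal (I : Data G) (u : V) (j : Fin (I.b u)) (R : Set V) : ℝ :=
  ∑ φ : Realization I, Realization.prob I φ *
    if φ.2 u j = true then ((reachAvoiding φ.1 R u).ncard : ℝ) else 0

theorem marginal_nonneg (u : V) (j : Fin (I.b u)) (R : Set V) : 0 ≤ marginal I u j R :=
  Finset.sum_nonneg fun φ _ => mul_nonneg (prob_nonneg φ) (by split_ifs <;> positivity)

theorem marginal_anti (u : V) (j : Fin (I.b u)) {R R' : Set V} (h : R' ⊆ R) :
    marginal I u j R ≤ marginal I u j R' := by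
  refine Finset.sum_le_sum fun φ _ => mul_le_mul_of_nonneg_left ?_ (prob_nonneg φ)
  split_ifs
  · exact Nat.cast_le.2 (Set.ncard_le_ncard (reachAvoiding_anti _ h u) (Set.toFinite _))
  · exact le_rfl

/-- All trials on a node have the same success probability. -/
theorem marginal_index (u : V) (j j' : Fin (I.b u)) (R : Set V) :
    marginal I u j R = marginal I u j' R := by
  -- `T` swaps the results of trials `j` and `j'` on `u`; this preserves probabilities and leaves
  -- the edges alone.
  let T : Realization I → Realization I := fun φ =>
    (φ.1, fun v => if h : v = u then
      fun i => φ.2 v (h ▸ Equiv.swap j j' (h ▸ i)) else φ.2 v)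
  have hTu : ∀ φ i, (T φ).2 u i = φ.2 u (Equiv.swap j j' i) := fun φ i => by simp [T]
  have hTv : ∀ φ v, v ≠ u → (T φ).2 v = φ.2 v := fun φ v h => by simp [T, h]
  have hT : Function.Involutive T := by
    intro φ
    refine Prod.ext rfl (funext fun v => ?_)
    by_cases h : v = u
    · subst h; funext i; rw [hTu, hTu, Equiv.swap_apply_self]
    · rw [hTv _ _ h, hTv _ _ h]
  have hP : ∀ φ, Realization.prob I (T φ) = Realization.prob I φ := by
    intro φ
    refine congrArg₂ _ rfl (Finset.prod_congr rfl fun v _ => ?_)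
    by_cases h : v = u
    · subst h
      simp only [hTu]
      exact Equiv.prod_comp (Equiv.swap j j') fun i => if φ.2 v i = true then I.β v else 1 - I.β v
    · simp only [hTv φ v h]
  rw [marginal, ← Equiv.sum_comp hT.toPerm]
  refine Finset.sum_congr rfl fun φ _ => ?_
  simp only [Function.Involutive.coe_toPerm, hP, hTu, Equiv.swap_apply_left]
  rfl

/-- The next trial on `u` and all edges leaving nodes outside the reached set are unobserved, hence
taken from `φ'`; the marginal gain involves nothing else beyond the reached set. -/
theorem sum_gain_splice (z : V → ℕ) (u : V) (hu : z u < I.b u) (φ : Realization I) :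
    ∑ φ', Realization.prob I φ' *
        (f I (z + Pi.single u 1) (splice (observe I z φ) φ φ') -
          f I z (splice (observe I z φ) φ φ')) =
      marginal I u ⟨z u, hu⟩ (reach φ.1 (seeds I z φ)) := by
  refine Finset.sum_congr rfl fun φ' _ => ?_
  rw [f_add_single_sub I z u hu, reach_eq_of_consistent (consistent_splice_observe z φ φ'),
    reachAvoiding_congr (g := φ'.1) (g' := (splice (observe I z φ) φ φ').1)]
  · simp [splice, observe]
  · intro e he
    simp [splice, observe, he]

end Resampling

/-! ### Costs of seeding vectors -/

section Cost

variable {V : Type*} {G : Digraph V} {I : Data G}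

theorem add_single_le [DecidableEq V] {x b : V → ℕ} (hx : x ≤ b) {u : V} (hu : x u < b u) :
    x + Pi.single u 1 ≤ b := by
  intro v
  by_cases h : v = u
  · subst h; simpa using hu
  · simpa [h] using hx v

theorem c_mono (hc : ∀ u i, 1 ≤ i → i < I.b u → I.c u i ≤ I.c u (i + 1)) {u : V} {i j : ℕ}
    (hi : 1 ≤ i) (hij : i ≤ j) (hj : j ≤ I.b u) : I.c u i ≤ I.c u j := by
  induction j, hij using Nat.le_induction with
  | base => exact le_rfl
  | succ j hij ih => exact (ih (by omega)).trans (hc u j (by omega) (by omega))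

variable [Fintype V]

theorem cost_nonneg {x : V → ℕ} (hx : x ≤ I.b) : 0 ≤ cost I x :=
  Finset.sum_nonneg fun u _ => Finset.sum_nonneg fun i hi =>
    (I.c_pos u i (Finset.mem_Icc.1 hi).1 ((Finset.mem_Icc.1 hi).2.trans (hx u))).le

theorem cost_mono {x y : V → ℕ} (hxy : x ≤ y) (hy : y ≤ I.b) : cost I x ≤ cost I y :=
  Finset.sum_le_sum fun u _ => Finset.sum_le_sum_of_subset_of_nonneg
    (Finset.Icc_subset_Icc_right (hxy u)) fun i hi _ =>
      (I.c_pos u i (Finset.mem_Icc.1 hi).1 ((Finset.mem_Icc.1 hi).2.trans (hy u))).le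

theorem cost_zero (I : Data G) : cost I 0 = 0 := by simp [cost]

theorem cost_add_single [DecidableEq V] (I : Data G) (x : V → ℕ) (u : V) :
    cost I (x + Pi.single u 1) = cost I x + I.c u (x u + 1) := by
  rw [cost, cost, ← Finset.add_sum_erase _ _ (Finset.mem_univ u),
    ← Finset.add_sum_erase _ (fun u => ∑ i ∈ Finset.Icc 1 (x u), I.c u i) (Finset.mem_univ u)]
  have h : ∑ v ∈ Finset.univ.erase u, ∑ i ∈ Finset.Icc 1 ((x + Pi.single u 1 : V → ℕ) v), I.c v i =
      ∑ v ∈ Finset.univ.erase u, ∑ i ∈ Finset.Icc 1 (x v), I.c v i := by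
    refine Finset.sum_congr rfl fun v hv => ?_
    simp [Finset.ne_of_mem_erase hv]
  rw [h, Pi.add_apply, Pi.single_eq_same, Finset.sum_Icc_succ_top (by omega)]
  ring

end Cost

/-! ### Runs of policies and adaptive submodularity -/

section Policies

variable {V : Type*} [DecidableEq V] {G : Digraph V} {I : Data G}

theorem le_step (π : Policy I) (φ : Realization I) (x : V → ℕ) : x ≤ step I π φ x := by
  unfold step
  split
  · exact le_rfl
  · exact le_add_of_nonneg_right fun _ => Nat.zero_le _

theorem iterate_step_mono (π : Policy I) (φ : Realization I) (x : V → ℕ) :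
    Monotone fun n => (step I π φ)^[n] x :=
  monotone_nat_of_le_succ fun n => by
    rw [Function.iterate_succ_apply']; exact le_step π φ _

theorem step_eq_of_observe_eq (π : Policy I) {φ φ' : Realization I} {x : V → ℕ}
    (h : observe I x φ' = observe I x φ) : step I π φ' x = step I π φ x := by
  simp only [step, h]

/-- The run of a policy is determined by what it has observed. -/
theorem iterate_step_eq_of_observe_eq (π : Policy I) {φ φ' : Realization I} {x : V → ℕ} {n : ℕ}
    {z : V → ℕ} (hz : (step I π φ)^[n] x ≤ z) (h : observe I z φ' = observe I z φ) :
    (step I π φ')^[n] x = (step I π φ)^[n] x := by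
  induction n with
  | zero => rfl
  | succ n ih =>
    have hn := (iterate_step_mono π φ x (Nat.le_succ n)).trans hz
    rw [Function.iterate_succ_apply', Function.iterate_succ_apply', ih hn]
    exact step_eq_of_observe_eq π (observe_eq_of_le hn h)

variable [Fintype V] [DecidableRel G.Adj]

open Classical in
theorem sum_gain (x : V → ℕ) (u : V) (hu : x u < I.b u) (φ₀ : Realization I) :
    ∑ φ : Realization I with observe I x φ = observe I x φ₀,
        Realization.prob I φ * (f I (x + Pi.single u 1) φ - f I x φ) =
      (∑ φ : Realization I with observe I x φ = observe I x φ₀, Realization.prob I φ) *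
        marginal I u ⟨x u, hu⟩ (reach φ₀.1 (seeds I x φ₀)) := by
  have h := sum_prob_eq_resample (I := I) (fun _ => x) (fun _ _ _ => rfl) fun φ =>
    if observe I x φ = observe I x φ₀ then f I (x + Pi.single u 1) φ - f I x φ else 0
  simp only [observe_splice] at h
  rw [Finset.sum_filter, Finset.sum_filter, Finset.sum_mul]
  simp only [mul_ite, mul_zero] at h
  rw [h]
  refine Finset.sum_congr rfl fun φ _ => ?_
  split_ifs with hφ
  · rw [sum_gain_splice x u hu φ,
      reach_eq_of_consistent ((consistent_iff_observe_eq I x φ₀ φ).2 hφ)]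
  · simp

-- On a fibre of probability zero `gain` is `0 / 0 = 0` and says nothing about `marginal`, hence
-- `hP`.
open Classical in
theorem gain_observe (x : V → ℕ) (u : V) (hu : x u < I.b u) (φ₀ : Realization I)
    (hP : ∑ φ : Realization I with observe I x φ = observe I x φ₀, Realization.prob I φ ≠ 0) :
    gain I u x (observe I x φ₀) = marginal I u ⟨x u, hu⟩ (reach φ₀.1 (seeds I x φ₀)) := by
  simp only [gain, condExp, consistent_iff_observe_eq]
  rw [sum_gain x u hu φ₀, mul_div_cancel_left₀ _ hP]

open Classical in
/-- Adaptive submodularity: if no trial has a marginal gain of more than `ρ` per unit of cost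
after the observation `ψ`, then no policy gains more than `ρ` per unit of its expected cost. -/
theorem sum_policy_gain_le (hc : ∀ u i, 1 ≤ i → i < I.b u → I.c u i ≤ I.c u (i + 1))
    (π : Policy I) (hη : ∀ φ, eta I π φ ≤ I.b) (x : V → ℕ) (ψ : PartialRealization I)
    (ρ : ℝ) (hρ₀ : 0 ≤ ρ)
    (hρ : ∀ φ, observe I x φ = ψ → ∀ v (hv : x v < I.b v),
      marginal I v ⟨x v, hv⟩ (reach φ.1 (seeds I x φ)) ≤ ρ * I.c v (x v + 1)) :
    ∑ φ : Realization I with observe I x φ = ψ,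
        Realization.prob I φ * (f I (eta I π φ) φ - f I x φ) ≤
      ρ * ∑ φ : Realization I with observe I x φ = ψ,
        Realization.prob I φ * cost I (eta I π φ) := by
  let y : ℕ → Realization I → V → ℕ := fun t φ => (step I π φ)^[t] 0
  have hys : ∀ t φ, y (t + 1) φ = step I π φ (y t φ) := fun t φ =>
    Function.iterate_succ_apply' _ _ _
  -- The policy runs from `0` on its own observations; its trials are merely joined to those of `x`,
  -- and each step is charged separately.
  have key : ∀ t, t ≤ ∑ u, I.b u + 1 →
      ∑ φ : Realization I with observe I x φ = ψ,
          Realization.prob I φ * (f I (x ⊔ y t φ) φ - f I x φ) ≤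
        ρ * ∑ φ : Realization I with observe I x φ = ψ,
          Realization.prob I φ * cost I (y t φ) := by
    intro t
    induction t with
    | zero =>
      intro _
      have h₀ : ∀ φ, x ⊔ y 0 φ = x := fun φ => sup_eq_left.2 fun _ => Nat.zero_le _
      simp only [h₀, sub_self, mul_zero, Finset.sum_const_zero]
      simp [y, cost_zero]
    | succ t ih =>
      intro ht
      have hb : ∀ φ, y (t + 1) φ ≤ I.b := fun φ => (iterate_step_mono π φ 0 ht).trans (hη φ)
      have hinc : ∑ φ : Realization I, Realization.prob I φ *
            (if observe I x φ = ψ then f I (x ⊔ y (t + 1) φ) φ - f I (x ⊔ y t φ) φ else 0) ≤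
          ∑ φ : Realization I, Realization.prob I φ *
            (if observe I x φ = ψ then ρ * (cost I (y (t + 1) φ) - cost I (y t φ)) else 0) := by
        -- What `x ⊔ y t` reveals determines `y t`, so everything else may be resampled.
        rw [sum_prob_eq_resample (I := I) (fun φ => x ⊔ y t φ) fun φ φ' h => by
          rw [show y t φ' = y t φ from iterate_step_eq_of_observe_eq π le_sup_right h]]
        refine Finset.sum_le_sum fun φ _ => mul_le_mul_of_nonneg_left ?_ (prob_nonneg φ)
        have hσ := observe_splice (I := I) (x ⊔ y t φ) φ
        have hσx := fun φ' => observe_eq_of_le (le_sup_left : x ≤ x ⊔ y t φ) (hσ φ')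
        have hσy : ∀ φ', y t (splice (observe I (x ⊔ y t φ) φ) φ φ') = y t φ := fun φ' =>
          iterate_step_eq_of_observe_eq π le_sup_right (hσ φ')
        have hσy' : ∀ φ', y (t + 1) (splice (observe I (x ⊔ y t φ) φ) φ φ') = y (t + 1) φ :=
          fun φ' => by
            rw [hys, hys, hσy]
            exact step_eq_of_observe_eq π (observe_eq_of_le le_sup_right (hσ φ'))
        simp only [hσx, hσy, hσy']
        by_cases hφ : observe I x φ = ψ
        swap
        · simp [hφ]
        simp only [hφ, if_true]
        have hbφ := hb φ
        rw [hys] at hbφ ⊢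
        unfold step at hbφ ⊢
        split
        · simp
        · next u hu =>
          simp only [hu] at hbφ
          have hu' : y t φ u + 1 ≤ I.b u := by simpa using hbφ u
          have hcy := I.c_pos u (y t φ u + 1) (by omega) hu'
          rw [cost_add_single, add_sub_cancel_left]
          -- If `x` already contains this trial, nothing is gained while the policy still pays.
          by_cases hxy : y t φ u < x u
          · have : x ⊔ (y t φ + Pi.single u 1) = x ⊔ y t φ := by
              funext v
              by_cases hv : v = u
              · subst hv; simp; omega
              · simp [hv]
            simp only [this, sub_self, mul_zero, Finset.sum_const_zero]
            positivity
          · push Not at hxy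
            have hz : (x ⊔ y t φ) u = y t φ u := by simpa using hxy
            have : x ⊔ (y t φ + Pi.single u 1) = x ⊔ y t φ + Pi.single u 1 := by
              funext v
              by_cases hv : v = u
              · subst hv; simp; omega
              · simp [hv]
            rw [this, sum_gain_splice _ u (by omega)]
            -- More is reached than after `x` alone, trials on `u` are exchangeable, and later
            -- trials on `u` cost no less.
            calc _ ≤ marginal I u ⟨(x ⊔ y t φ) u, by omega⟩ (reach φ.1 (seeds I x φ)) :=
                  marginal_anti u _ (reach_mono _ (seeds_mono I le_sup_left φ))
              _ = marginal I u ⟨x u, by omega⟩ (reach φ.1 (seeds I x φ)) :=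
                  marginal_index u _ _ _
              _ ≤ ρ * I.c u (x u + 1) := hρ φ hφ u _
              _ ≤ ρ * I.c u (y t φ u + 1) :=
                  mul_le_mul_of_nonneg_left (c_mono hc (by omega) (by omega) hu') hρ₀
      simp only [mul_ite, mul_zero, ← Finset.sum_filter] at hinc
      have ih' := ih (by omega)
      rw [Finset.mul_sum] at ih' ⊢
      have h := add_le_add ih' hinc
      rw [← Finset.sum_add_distrib, ← Finset.sum_add_distrib] at h
      exact (Finset.sum_congr rfl fun φ _ => by ring).trans_le
        (h.trans_eq (Finset.sum_congr rfl fun φ _ => by ring))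
  refine le_trans ?_ (key _ le_rfl)
  refine Finset.sum_le_sum fun φ _ => mul_le_mul_of_nonneg_left ?_ (prob_nonneg φ)
  exact sub_le_sub_right (f_mono I le_sup_right φ) _

end Policies

/-! ### The greedy policy against a benchmark -/

section Greedy

variable {V : Type*} [Fintype V] [DecidableEq V] {G : Digraph V} {I : Data G}
  {sel : Policy I}

open Classical in
/-- The expectation over `κ` of `h` at the vector that the randomized greedy policy reaches from
`x` after at most `n` trials. -/
def greedyValue (I : Data G) (sel : Policy I) (φ : Realization I) (h : (V → ℕ) → ℝ) :
    ℕ → (V → ℕ) → ℝ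
  | 0, x => h x
  | n + 1, x =>
    if cost I x < I.k then
      match sel x (observe I x φ) with
      | none => h x
      | some u =>
        -- A trial over budget ends the run, so this branch does not recurse.
        if I.k < cost I x + I.c u (x u + 1) then
          h x + (I.k - cost I x) / I.c u (x u + 1) * (h (x + Pi.single u 1) - h x)
        else greedyValue I sel φ h n (x + Pi.single u 1)
    else h x

theorem step_greedy_of_le (κ : unitInterval) (φ : Realization I) {x : V → ℕ}
    (hx : I.k ≤ cost I x) : step I (greedy I sel κ) φ x = x := by
  simp [step, greedy, hx.not_gt]

theorem step_greedy_of_none (κ : unitInterval) {φ : Realization I} {x : V → ℕ}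
    (hs : sel x (observe I x φ) = none) : step I (greedy I sel κ) φ x = x := by
  simp [step, greedy, hs]

theorem step_greedy_of_some (κ : unitInterval) {φ : Realization I} {x : V → ℕ} {u : V}
    (hx : cost I x < I.k) (hs : sel x (observe I x φ) = some u) :
    step I (greedy I sel κ) φ x =
      if I.k < cost I x + I.c u (x u + 1) ∧ (I.k - cost I x) / I.c u (x u + 1) < (κ : ℝ)
      then x else x + Pi.single u 1 := by
  simp only [step, greedy, hs, hx, if_true]
  split_ifs <;> rfl

theorem integral_ite_lt_unitInterval (r : unitInterval) (a b : ℝ) :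
    ∫ κ : unitInterval, (if r < κ then a else b) = a + r * (b - a) := by
  have h : (fun κ : unitInterval => if r < κ then a else b) =
      fun κ => a + (Set.Iic r).indicator (fun _ => b - a) κ := by
    funext κ
    by_cases hκ : r < κ
    · simp [hκ, Set.indicator]
    · simp [hκ, Set.indicator, not_lt.1 hκ]
  rw [h, integral_add (integrable_const _) ((integrable_const _).indicator measurableSet_Iic),
    integral_const, integral_indicator_const _ measurableSet_Iic]
  simp [Measure.real, unitInterval.volume_Iic, r.2.1]

variable [DecidableRel G.Adj]

/-- One `κ` serves the whole run because it matters only at the trial over budget: until then the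
run is the same for all `κ`, and afterwards it is constant. -/
theorem integral_iterate_greedy (hsel : IsGreedySelection I sel) (φ : Realization I)
    (h : (V → ℕ) → ℝ) (n : ℕ) (x : V → ℕ) :
    ∫ κ : unitInterval, h ((step I (greedy I sel κ) φ)^[n] x) = greedyValue I sel φ h n x := by
  induction n generalizing x with
  | zero => simp [greedyValue]
  | succ n ih =>
    rw [greedyValue]
    by_cases hx : cost I x < I.k
    swap
    · rw [if_neg hx]
      simp [Function.iterate_fixed (step_greedy_of_le (sel := sel) _ φ (not_lt.1 hx))]
    rw [if_pos hx]
    split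
    · next hs => simp [Function.iterate_fixed (step_greedy_of_none _ hs)]
    · next u hs =>
      have hu := ((hsel x (observe I x φ)).2 u hs).1
      have hcu := I.c_pos u (x u + 1) (by omega) hu
      split_ifs with hk
      · set r := (I.k - cost I x) / I.c u (x u + 1) with hr
        have hr₁ : r ∈ Set.Icc (0 : ℝ) 1 :=
          ⟨div_nonneg (by linarith) hcu.le, (div_le_one hcu).2 (by linarith)⟩
        rw [← integral_ite_lt_unitInterval ⟨r, hr₁⟩]
        refine integral_congr_ae (.of_forall fun κ => ?_)
        have hst := step_greedy_of_some κ hx hs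
        simp only [hk, true_and, ← hr] at hst
        by_cases hκ : r < κ
        · rw [if_pos hκ] at hst
          have : (⟨r, hr₁⟩ : unitInterval) < κ := hκ
          simp only [Function.iterate_fixed hst, this, if_true]
        · rw [if_neg hκ] at hst
          have : ¬ (⟨r, hr₁⟩ : unitInterval) < κ := hκ
          simp only [Function.iterate_succ_apply, hst, this, if_false]
          rw [Function.iterate_fixed (step_greedy_of_le κ φ _)]
          rw [cost_add_single]; exact hk.le
      · rw [← ih]
        refine integral_congr_ae (.of_forall fun κ => ?_)
        have hst := step_greedy_of_some κ hx hs
        simp only [hk, false_and, if_false] at hst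
        simp only [Function.iterate_succ_apply, hst]

theorem iterate_greedy_le (hsel : IsGreedySelection I sel) (κ : unitInterval)
    (φ : Realization I) (n : ℕ) : (step I (greedy I sel κ) φ)^[n] 0 ≤ I.b := by
  induction n with
  | zero => exact fun _ => Nat.zero_le _
  | succ n ih =>
    rw [Function.iterate_succ_apply']
    set x := (step I (greedy I sel κ) φ)^[n] 0
    by_cases hx : cost I x < I.k
    · cases hs : sel x (observe I x φ) with
      | none => rwa [step_greedy_of_none κ hs]
      | some u =>
        rw [step_greedy_of_some κ hx hs]
        split_ifs
        · exact ih
        · exact add_single_le ih ((hsel x _).2 u hs).1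
    · rwa [step_greedy_of_le κ φ (not_lt.1 hx)]

/-- The acceptance probability of a trial over budget is chosen so that its expected cost is exactly
the remaining budget. -/
theorem greedyValue_cost_le (hsel : IsGreedySelection I sel) (φ : Realization I) (n : ℕ)
    (x : V → ℕ) (hx : cost I x ≤ I.k) : greedyValue I sel φ (cost I) n x ≤ I.k := by
  induction n generalizing x with
  | zero => exact hx
  | succ n ih =>
    rw [greedyValue]
    split_ifs with hk
    · split
      · exact hx
      · next u hs =>
        have hu := ((hsel x (observe I x φ)).2 u hs).1
        have hcu := I.c_pos u (x u + 1) (by omega) hu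
        split_ifs with hk'
        · rw [cost_add_single, add_sub_cancel_left, div_mul_cancel₀ _ hcu.ne']
          linarith
        · exact ih _ (by rw [cost_add_single]; linarith)
    · exact hx

theorem le_greedyValue (hsel : IsGreedySelection I sel) (φ : Realization I)
    {h : (V → ℕ) → ℝ} (hh : Monotone h) (n : ℕ) (x : V → ℕ) :
    h x ≤ greedyValue I sel φ h n x := by
  induction n generalizing x with
  | zero => exact le_rfl
  | succ n ih =>
    rw [greedyValue]
    split_ifs with hk
    · split
      · exact le_rfl
      · next u hs =>
        have hu := ((hsel x (observe I x φ)).2 u hs).1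
        have hcu := I.c_pos u (x u + 1) (by omega) hu
        have hxu := hh (le_add_of_nonneg_right (fun _ => Nat.zero_le _) : x ≤ x + Pi.single u 1)
        split_ifs with hk'
        · exact le_add_of_nonneg_right
            (mul_nonneg (div_nonneg (by linarith) hcu.le) (sub_nonneg.2 hxu))
        · exact hxu.trans (ih _)
    · exact le_rfl

open Classical in
/-- `O` is a benchmark that gains at most `ρ * k` in expectation after any observation in which
no trial has a marginal gain of more than `ρ` per unit of cost. -/
def IsBenchmark (I : Data G) (O : Realization I → ℝ) : Prop :=
  ∀ x ≤ I.b, ∀ (ψ : PartialRealization I) (ρ : ℝ), 0 ≤ ρ →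
    (∀ φ, observe I x φ = ψ → ∀ v (hv : x v < I.b v),
      marginal I v ⟨x v, hv⟩ (reach φ.1 (seeds I x φ)) ≤ ρ * I.c v (x v + 1)) →
    ∑ φ : Realization I with observe I x φ = ψ, Realization.prob I φ * (O φ - f I x φ) ≤
      ρ * (I.k * ∑ φ : Realization I with observe I x φ = ψ, Realization.prob I φ)

-- With no trial left the condition on `ρ` is vacuous, so `ρ = 0` is allowed.
open Classical in
theorem IsBenchmark.le_zero {O : Realization I → ℝ} (hO : IsBenchmark I O) {x : V → ℕ}
    (hx : x ≤ I.b) (hbx : ∀ u, I.b u ≤ x u) (ψ : PartialRealization I) :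
    ∑ φ : Realization I with observe I x φ = ψ, Realization.prob I φ * (O φ - f I x φ) ≤ 0 := by
  simpa using hO x hx ψ 0 le_rfl fun _ _ v hv => absurd hv (hbx v).not_gt

open Classical in
theorem IsBenchmark.le_sel {O : Realization I → ℝ} (hO : IsBenchmark I O)
    (hsel : IsGreedySelection I sel) {x : V → ℕ} (hx : x ≤ I.b) (φ₀ : Realization I) {u : V}
    (hs : sel x (observe I x φ₀) = some u) :
    ∑ φ : Realization I with observe I x φ = observe I x φ₀,
        Realization.prob I φ * (O φ - f I x φ) ≤
      I.k / I.c u (x u + 1) * ∑ φ : Realization I with observe I x φ = observe I x φ₀,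
        Realization.prob I φ * (f I (x + Pi.single u 1) φ - f I x φ) := by
  obtain ⟨hu, hmax⟩ := (hsel x (observe I x φ₀)).2 u hs
  have hcu := I.c_pos u (x u + 1) (by omega) hu
  -- On a null fibre the greedy ratios carry no information, but both sides vanish.
  by_cases hP : ∑ φ : Realization I with observe I x φ = observe I x φ₀, Realization.prob I φ = 0
  · have h₀ : ∀ φ, observe I x φ = observe I x φ₀ → Realization.prob I φ = 0 := fun φ hφ =>
      (Finset.sum_eq_zero_iff_of_nonneg fun φ _ => prob_nonneg φ).1 hP φ (by simpa using hφ)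
    rw [Finset.sum_eq_zero, Finset.sum_eq_zero, mul_zero] <;>
    · intro φ hφ
      rw [h₀ φ (Finset.mem_filter.1 hφ).2, zero_mul]
  · have hρ := hO x hx (observe I x φ₀)
      (marginal I u ⟨x u, hu⟩ (reach φ₀.1 (seeds I x φ₀)) / I.c u (x u + 1))
      (div_nonneg (marginal_nonneg _ _ _) hcu.le) fun φ hφ v hv => by
        have hcv := I.c_pos v (x v + 1) (by omega) hv
        have h := hmax v hv
        rw [gain_observe x u hu φ₀ hP, gain_observe x v hv φ₀ hP, div_le_iff₀ hcv] at h
        rwa [reach_eq_of_consistent ((consistent_iff_observe_eq I x φ₀ φ).2 hφ)]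
    refine hρ.trans_eq ?_
    rw [sum_gain x u hu φ₀]
    ring

-- The sums are not normalized, so they add up over finer fibres without dividing by probabilities.
-- `hn` says that `n` steps can exhaust all remaining trials.
open Classical in
theorem IsBenchmark.le_greedyValue {O : Realization I → ℝ} (hO : IsBenchmark I O)
    (hsel : IsGreedySelection I sel) (hk : 0 < I.k) (n : ℕ) (x : V → ℕ) (hx : x ≤ I.b)
    (hxk : cost I x ≤ I.k) (hn : ∑ u, I.b u ≤ n + ∑ u, x u) (φ₀ : Realization I) :
    (1 - Real.exp (-((I.k - cost I x) / I.k))) *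
        ∑ φ : Realization I with observe I x φ = observe I x φ₀,
          Realization.prob I φ * (O φ - f I x φ) ≤
      ∑ φ : Realization I with observe I x φ = observe I x φ₀,
        Realization.prob I φ * (greedyValue I sel φ (fun y => f I y φ) n x - f I x φ) := by
  induction n generalizing x φ₀ with
  | zero =>
    have hbx : ∀ u, I.b u ≤ x u := by
      by_contra! h
      obtain ⟨u, hu⟩ := h
      have := Finset.sum_lt_sum (fun i _ => hx i) ⟨u, Finset.mem_univ u, hu⟩
      omega
    refine (mul_nonpos_of_nonneg_of_nonpos (sub_nonneg.2 (Real.exp_le_one_iff.2 ?_))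
      (hO.le_zero hx hbx _)).trans_eq ?_
    · exact neg_nonpos.2 (div_nonneg (by linarith) hk.le)
    · simp [greedyValue]
  | succ n ih =>
    set S := ∑ φ : Realization I with observe I x φ = observe I x φ₀,
          Realization.prob I φ * (O φ - f I x φ) with hS
    have hcoef : 0 ≤ 1 - Real.exp (-((I.k - cost I x) / I.k)) :=
      sub_nonneg.2 (Real.exp_le_one_iff.2 (neg_nonpos.2 (div_nonneg (by linarith) hk.le)))
    have hnonneg : 0 ≤ ∑ φ : Realization I with observe I x φ = observe I x φ₀,
        Realization.prob I φ * (greedyValue I sel φ (fun y => f I y φ) (n + 1) x - f I x φ) :=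
      Finset.sum_nonneg fun φ _ => mul_nonneg (prob_nonneg φ)
        (sub_nonneg.2 (IMMA.le_greedyValue hsel φ (fun _ _ h => f_mono I h φ) _ x))
    by_cases hS₀ : S ≤ 0
    · exact (mul_nonpos_of_nonneg_of_nonpos hcoef hS₀).trans hnonneg
    push Not at hS₀
    rcases hxk.eq_or_lt with hxk' | hxk'
    · simpa [hxk'] using hnonneg
    cases hs : sel x (observe I x φ₀) with
    | none => exact absurd (hO.le_zero hx ((hsel x _).1 hs) _) hS₀.not_ge
    | some u =>
      have hu := ((hsel x _).2 u hs).1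
      have hcu := I.c_pos u (x u + 1) (by omega) hu
      have hSD := hO.le_sel hsel hx φ₀ hs
      set D := ∑ φ : Realization I with observe I x φ = observe I x φ₀,
        Realization.prob I φ * (f I (x + Pi.single u 1) φ - f I x φ) with hD
      rw [← hS, div_mul_eq_mul_div, le_div_iff₀ hcu] at hSD
      have hunfold : ∀ φ, observe I x φ = observe I x φ₀ →
          greedyValue I sel φ (fun y => f I y φ) (n + 1) x =
            if I.k < cost I x + I.c u (x u + 1) then
              f I x φ + (I.k - cost I x) / I.c u (x u + 1) *
                (f I (x + Pi.single u 1) φ - f I x φ)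
            else greedyValue I sel φ (fun y => f I y φ) n (x + Pi.single u 1) := by
        intro φ hφ
        rw [greedyValue, if_pos hxk', hφ, hs]
      by_cases hover : I.k < cost I x + I.c u (x u + 1)
      · have hsum : ∑ φ : Realization I with observe I x φ = observe I x φ₀,
            Realization.prob I φ * (greedyValue I sel φ (fun y => f I y φ) (n + 1) x - f I x φ) =
            (I.k - cost I x) / I.c u (x u + 1) * D := by
          rw [hD, Finset.mul_sum]
          refine Finset.sum_congr rfl fun φ hφ => ?_
          rw [hunfold φ (Finset.mem_filter.1 hφ).2, if_pos hover]
          ring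
        rw [hsum]
        have hexp := Real.one_sub_le_exp_neg ((I.k - cost I x) / I.k)
        calc _ ≤ (I.k - cost I x) / I.k * S :=
              mul_le_mul_of_nonneg_right (by linarith) hS₀.le
          _ = (I.k - cost I x) / (I.k * I.c u (x u + 1)) * (S * I.c u (x u + 1)) := by
              field_simp
          _ ≤ (I.k - cost I x) / (I.k * I.c u (x u + 1)) * (I.k * D) :=
              mul_le_mul_of_nonneg_left hSD (div_nonneg (by linarith) (by positivity))
          _ = _ := by field_simp
      · set x' := x + Pi.single u 1 with hx'
        have hxx' : x ≤ x' := le_add_of_nonneg_right fun _ => Nat.zero_le _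
        have hcx' : cost I x' = cost I x + I.c u (x u + 1) := cost_add_single I x u
        have hsx' : ∑ v, x' v = ∑ v, x v + 1 := by
          simp [hx', Finset.sum_add_distrib]
        -- The observation at `x'` refines the one at `x`; the induction hypothesis is applied on
        -- each finer fibre and summed.
        have hfib : (1 - Real.exp (-((I.k - cost I x') / I.k))) *
              ∑ φ : Realization I with observe I x φ = observe I x φ₀,
                Realization.prob I φ * (O φ - f I x' φ) ≤
            ∑ φ : Realization I with observe I x φ = observe I x φ₀,
              Realization.prob I φ *
                (greedyValue I sel φ (fun y => f I y φ) n x' - f I x' φ) := by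
          rw [← Finset.sum_fiberwise _ (fun φ => observe I x' φ),
            ← Finset.sum_fiberwise _ (fun φ => observe I x' φ)
              (fun φ => Realization.prob I φ *
                (greedyValue I sel φ (fun y => f I y φ) n x' - f I x' φ)), Finset.mul_sum]
          refine Finset.sum_le_sum fun ω _ => ?_
          by_cases hne : ∃ φ, observe I x φ = observe I x φ₀ ∧ observe I x' φ = ω
          · obtain ⟨φ₁, h₁, rfl⟩ := hne
            have hfilter : ((Finset.univ : Finset (Realization I)).filter
                (fun φ => observe I x φ = observe I x φ₀)).filter
                  (fun φ => observe I x' φ = observe I x' φ₁) =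
                Finset.univ.filter fun φ => observe I x' φ = observe I x' φ₁ := by
              ext φ
              simp only [Finset.mem_filter, Finset.mem_univ, true_and, and_iff_right_iff_imp]
              exact fun h => (observe_eq_of_le hxx' h).trans h₁
            rw [hfilter]
            exact ih x' (add_single_le hx hu) (by linarith) (by omega) φ₁
          · have hfilter : ((Finset.univ : Finset (Realization I)).filter
                (fun φ => observe I x φ = observe I x φ₀)).filter
                  (fun φ => observe I x' φ = ω) = ∅ := by
              ext φ
              simp only [Finset.mem_filter, Finset.mem_univ, true_and, Finset.notMem_empty,
                iff_false]
              exact fun h => hne ⟨φ, h⟩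
            rw [hfilter]
            simp
        have hSx' : ∑ φ : Realization I with observe I x φ = observe I x φ₀,
            Realization.prob I φ * (O φ - f I x' φ) = S - D := by
          rw [hS, hD, ← Finset.sum_sub_distrib]
          exact Finset.sum_congr rfl fun φ _ => by ring
        have hsum : ∑ φ : Realization I with observe I x φ = observe I x φ₀,
            Realization.prob I φ * (greedyValue I sel φ (fun y => f I y φ) (n + 1) x - f I x φ) =
            (∑ φ : Realization I with observe I x φ = observe I x φ₀,
              Realization.prob I φ *
                (greedyValue I sel φ (fun y => f I y φ) n x' - f I x' φ)) + D := by
          rw [hD, ← Finset.sum_add_distrib]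
          refine Finset.sum_congr rfl fun φ hφ => ?_
          rw [hunfold φ (Finset.mem_filter.1 hφ).2, if_neg hover]
          ring
        rw [hSx'] at hfib
        rw [hsum]
        have hexp : Real.exp (-((I.k - cost I x) / I.k)) =
            Real.exp (-((I.k - cost I x') / I.k)) * Real.exp (-(I.c u (x u + 1) / I.k)) := by
          rw [← Real.exp_add, hcx']
          congr 1
          field_simp
          ring
        have hexp' := Real.one_sub_le_exp_neg (I.c u (x u + 1) / I.k)
        set E := Real.exp (-((I.k - cost I x') / I.k)) with hE
        have hE₀ : 0 ≤ E := (Real.exp_pos _).le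
        have hSD' : S * (I.c u (x u + 1) / I.k) ≤ D := by
          rw [mul_div_assoc', div_le_iff₀ hk]
          linarith
        rw [hexp]
        -- Here `exp (-c/k) ≥ 1 - c/k` is combined with `S * c/k ≤ D`; the sign of `S` is needed for
        -- the first step.
        calc _ ≤ (1 - E * (1 - I.c u (x u + 1) / I.k)) * S :=
              mul_le_mul_of_nonneg_right
                (sub_le_sub_left (mul_le_mul_of_nonneg_left hexp' hE₀) _) hS₀.le
          _ = (1 - E) * S + E * (S * (I.c u (x u + 1) / I.k)) := by ring
          _ ≤ (1 - E) * S + E * D := by gcongr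
          _ = (1 - E) * (S - D) + D := by ring
          _ ≤ _ := by gcongr

end Greedy

/-! ### Averaging over the random source -/

section RandomizedPolicies

variable {V : Type*} [Fintype V] {G : Digraph V} {I : Data G} {K : Type*} [MeasurableSpace K]
  {π : K → Policy I}

theorem measurableSet_greedy (sel : Policy I) (x : V → ℕ) (ψ : PartialRealization I)
    (o : Option V) : MeasurableSet {κ | greedy I sel κ x ψ = o} := by
  unfold greedy
  by_cases hx : cost I x < I.k
  swap
  · simp only [hx, if_false]; exact .const _
  simp only [hx, if_true]
  cases sel x ψ with
  | none => exact MeasurableSet.const (none = o)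
  | some u =>
    simp only
    have h : {κ : unitInterval | I.k < cost I x + I.c u (x u + 1) ∧
        (I.k - cost I x) / I.c u (x u + 1) < (κ : ℝ)} =
        {_κ | I.k < cost I x + I.c u (x u + 1)} ∩
          Subtype.val ⁻¹' Set.Ioi ((I.k - cost I x) / I.c u (x u + 1)) := rfl
    refine (Measurable.ite (f := fun _ => none) (g := fun _ => some u) (m := inferInstance)
      (mβ := (⊤ : MeasurableSpace (Option V))) ?_ measurable_const measurable_const)
      (t := {o}) trivial
    rw [h]
    exact (MeasurableSet.const _).inter (measurable_subtype_coe measurableSet_Ioi)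

variable [DecidableEq V]

theorem measurable_iterate_step (hm : ∀ x ψ o, MeasurableSet {κ | π κ x ψ = o})
    (φ : Realization I) (n : ℕ) (x : V → ℕ) : Measurable fun κ => (step I (π κ) φ)^[n] x := by
  induction n with
  | zero => exact measurable_const
  | succ n ih =>
    refine measurable_to_countable' fun y => ?_
    have h : (fun κ => (step I (π κ) φ)^[n + 1] x) ⁻¹' {y} =
        ⋃ z : V → ℕ, ⋃ o : Option V,
          ((fun κ => (step I (π κ) φ)^[n] x) ⁻¹' {z} ∩ {κ | π κ z (observe I z φ) = o}) ∩
            {_κ | step I (fun _ _ => o) φ z = y} := by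
      ext κ
      simp [Function.iterate_succ_apply', step]
    rw [h]
    exact .iUnion fun z => .iUnion fun o =>
      ((ih (measurableSet_singleton z)).inter (hm _ _ _)).inter (.const _)

theorem integrable_f_eta (hm : ∀ x ψ o, MeasurableSet {κ | π κ x ψ = o}) (φ : Realization I)
    (μ : Measure K) [IsFiniteMeasure μ] : Integrable (fun κ => f I (eta I (π κ) φ) φ) μ := by
  refine .of_bound ((measurable_of_countable fun y => f I y φ).comp
    (measurable_iterate_step hm φ _ 0)).aestronglyMeasurable (Nat.card V) (.of_forall fun κ => ?_)
  rw [Real.norm_of_nonneg (f_nonneg _ _ _)]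
  exact f_le _ _ _

theorem integrable_cost_eta (hm : ∀ x ψ o, MeasurableSet {κ | π κ x ψ = o}) (φ : Realization I)
    (μ : Measure K) [IsFiniteMeasure μ] (hη : ∀ᵐ κ ∂μ, eta I (π κ) φ ≤ I.b) :
    Integrable (fun κ => cost I (eta I (π κ) φ)) μ := by
  refine .of_bound ((measurable_of_countable (cost I)).comp
    (measurable_iterate_step hm φ _ 0)).aestronglyMeasurable (cost I I.b) (hη.mono fun κ hκ => ?_)
  rw [Real.norm_of_nonneg (cost_nonneg hκ)]
  exact cost_mono hκ le_rfl

variable [DecidableRel G.Adj]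

theorem integral_favg (hm : ∀ x ψ o, MeasurableSet {κ | π κ x ψ = o})
    (μ : Measure K) [IsFiniteMeasure μ] :
    ∫ κ, favg I (π κ) ∂μ =
      ∑ φ : Realization I, Realization.prob I φ * ∫ κ, f I (eta I (π κ) φ) φ ∂μ := by
  simp only [favg]
  rw [integral_finsetSum _ fun φ _ => (integrable_f_eta hm φ μ).const_mul _]
  simp only [integral_const_mul]

/-- For a single `κ` the cost may exceed `k`. Adaptive submodularity is therefore applied for each
`κ` with the actual cost, and the budget enters only after integrating, separately for each `φ`. -/
theorem IsFeasible.isBenchmark (hc : ∀ u i, 1 ≤ i → i < I.b u → I.c u i ≤ I.c u (i + 1))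
    {μ : Measure K} [IsProbabilityMeasure μ] (h : IsFeasible I μ π) :
    IsBenchmark I fun φ => ∫ κ, f I (eta I (π κ) φ) φ ∂μ := by
  classical
  intro x _ ψ ρ hρ₀ hρ
  have hf := fun φ => integrable_f_eta h.measurable φ μ
  have hcost := fun φ => integrable_cost_eta h.measurable φ μ (h.eta_le φ)
  calc _ = ∑ φ : Realization I with observe I x φ = ψ,
          ∫ κ, Realization.prob I φ * (f I (eta I (π κ) φ) φ - f I x φ) ∂μ := by
        refine Finset.sum_congr rfl fun φ _ => ?_
        rw [integral_const_mul, integral_sub (hf φ) (integrable_const _)]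
        simp
    _ = ∫ κ, ∑ φ : Realization I with observe I x φ = ψ,
          Realization.prob I φ * (f I (eta I (π κ) φ) φ - f I x φ) ∂μ :=
        (integral_finsetSum _ fun φ _ => ((hf φ).sub (integrable_const _)).const_mul _).symm
    _ ≤ ∫ κ, ρ * ∑ φ : Realization I with observe I x φ = ψ,
          Realization.prob I φ * cost I (eta I (π κ) φ) ∂μ := by
        refine integral_mono_ae
          (integrable_finsetSum _ fun φ _ => ((hf φ).sub (integrable_const _)).const_mul _)
          ((integrable_finsetSum _ fun φ _ => (hcost φ).const_mul _).const_mul _) ?_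
        filter_upwards [ae_all_iff.2 h.eta_le] with κ hκ
        exact sum_policy_gain_le hc (π κ) hκ x ψ ρ hρ₀ hρ
    _ = ρ * ∑ φ : Realization I with observe I x φ = ψ,
          Realization.prob I φ * ∫ κ, cost I (eta I (π κ) φ) ∂μ := by
        rw [integral_const_mul, integral_finsetSum _ fun φ _ => (hcost φ).const_mul _]
        simp only [integral_const_mul]
    _ ≤ _ := by
        rw [Finset.mul_sum _ _ I.k]
        refine mul_le_mul_of_nonneg_left (Finset.sum_le_sum fun φ _ => ?_) hρ₀
        rw [mul_comm I.k]
        exact mul_le_mul_of_nonneg_left (h.cost_le φ) (prob_nonneg φ)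

theorem isFeasible_greedy {sel : Policy I} (hsel : IsGreedySelection I sel) :
    IsFeasible I (volume : Measure unitInterval) (greedy I sel) where
  measurable := measurableSet_greedy sel
  eta_le φ := .of_forall fun κ => iterate_greedy_le hsel κ φ _
  cost_le φ := by
    refine (integral_iterate_greedy hsel φ (cost I) _ 0).trans_le
      (greedyValue_cost_le hsel φ _ 0 ?_)
    rw [cost_zero]; exact I.k_nonneg

theorem integral_favg_greedy_ge {sel : Policy I} (hsel : IsGreedySelection I sel)
    {O : Realization I → ℝ} (hO : IsBenchmark I O) :
    (1 - Real.exp (-1)) * ∑ φ : Realization I, Realization.prob I φ * O φ ≤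
      ∫ κ : unitInterval, favg I (greedy I sel κ) := by
  classical
  have hgreedy := integral_favg (μ := volume) (measurableSet_greedy sel)
  have hnonneg : 0 ≤ ∫ κ : unitInterval, favg I (greedy I sel κ) := by
    rw [hgreedy]
    exact Finset.sum_nonneg fun φ _ => mul_nonneg (prob_nonneg φ)
      (integral_nonneg fun κ => f_nonneg _ _ _)
  -- Any realization would do: at `x = 0` nothing is observed, so there is a single fibre.
  let φ₀ : Realization I := (fun _ => false, fun _ _ => false)
  have hobs : ∀ φ, observe I 0 φ = observe I 0 φ₀ := fun φ => by
    rw [← consistent_iff_observe_eq, consistent_observe_iff]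
    simp [reach, seeds_zero]
  have hb : (0 : V → ℕ) ≤ I.b := fun _ => Nat.zero_le _
  -- For `k = 0` the exponent `B/k` is meaningless, but the benchmark property already forces the
  -- expectation of `O` to be at most `0`.
  rcases I.k_nonneg.eq_or_lt with hk | hk
  · refine (mul_nonpos_of_nonneg_of_nonpos (by simp) ?_).trans hnonneg
    cases hs : sel 0 (observe I 0 φ₀) with
    | none => simpa [hobs, f_zero] using hO.le_zero hb ((hsel _ _).1 hs) (observe I 0 φ₀)
    | some u => simpa [hobs, f_zero, ← hk] using hO.le_sel hsel hb φ₀ hs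
  · have h := hO.le_greedyValue hsel hk (∑ u, I.b u + 1) 0 hb (by rw [cost_zero]; exact hk.le)
      (by omega) φ₀
    simp only [hobs, cost_zero, f_zero, sub_zero, div_self hk.ne', Finset.filter_true] at h
    refine h.trans_eq ?_
    rw [hgreedy]
    exact Finset.sum_congr rfl fun φ _ =>
      congrArg _ (integral_iterate_greedy hsel φ (fun y => f I y φ) _ 0).symm

end RandomizedPolicies

end IMMA

end

theorem theorem3 {V : Type*} [Fintype V] [DecidableEq V] (G : Digraph V) [DecidableRel G.Adj]
    (I : IMMA.Data G)
    (hc : ∀ u i, 1 ≤ i → i < I.b u → I.c u i ≤ I.c u (i + 1))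
    (sel : IMMA.Policy I) (hsel : IMMA.IsGreedySelection I sel) :
    IMMA.IsFeasible I (volume : Measure unitInterval) (IMMA.greedy I sel) ∧
    ∀ {K : Type*} [MeasurableSpace K] (μ : Measure K) [IsProbabilityMeasure μ]
      (π : K → IMMA.Policy I), IMMA.IsFeasible I μ π →
      (1 - Real.exp (-1)) * ∫ κ, IMMA.favg I (π κ) ∂μ ≤
        ∫ κ : unitInterval, IMMA.favg I (IMMA.greedy I sel κ) := by
  refine ⟨IMMA.isFeasible_greedy hsel, fun μ _ π hπ => ?_⟩
  rw [IMMA.integral_favg hπ.measurable]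
  exact IMMA.integral_favg_greedy_ge hsel (hπ.isBenchmark hc)
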